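/- Let $B$ be a Boolean algebra. An ultrafilter of $B$ is a maximal proper filter of $B$. The topological density $d(B)$ is the least cardinal $\kappa$ such that there is a family $\{D_\xi : \xi<\kappa\}$ of ultrafilters of $B$ with $\bigcup_{\xi<\kappa} D_\xi = B\setminus\{0\}$. The algebra $B$ satisfies the countable chain condition (ccc) if there is no uncountable set of pairwise disjoint elements of $B\setminus\{0\}$. Theorem (ZFC). For every uncountable cardinal $\mu$ there is a ccc Boolean algebra $B$ such that $d(B)=\mu$. -/

import Mathlib

universe u

/-- The countable chain condition for a Boolean algebra: there is no uncountable set of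
pairwise disjoint nonzero elements. -/
def BACountableChainCondition (B : Type u) [BooleanAlgebra B] : Prop :=
  ∀ A : Set B, (∀ a ∈ A, a ≠ ⊥) → A.Pairwise Disjoint → A.Countable

/-- An ultrafilter of a Boolean algebra: a filter which is maximal among the proper filters. -/
def IsBAUltrafilter {B : Type u} [BooleanAlgebra B] (D : Order.PFilter B) : Prop :=
  Maximal (fun G : Order.PFilter B => ⊥ ∉ G) D

/-- `CoveredByUltrafilters B κ`: there is a family of ultrafilters of `B`, indexed by a set of
cardinality `κ`, whose union is the set of all nonzero elements of `B`. -/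
def CoveredByUltrafilters (B : Type u) [BooleanAlgebra B] (κ : Cardinal.{u}) : Prop :=
  ∃ (ι : Type u) (D : ι → Order.PFilter B), Cardinal.mk ι = κ ∧
    (∀ i, IsBAUltrafilter (D i)) ∧ (⋃ i, (D i : Set B)) = {b : B | b ≠ ⊥}

/-- The topological density `d(B)`: the least `κ` such that `B \ {0}` is the union of a family
of `κ` many ultrafilters of `B`. -/
noncomputable def topologicalDensity (B : Type u) [BooleanAlgebra B] : Cardinal.{u} :=
  sInf {κ : Cardinal.{u} | CoveredByUltrafilters B κ}

/-!
By Stone duality it suffices to find, for every cardinal `μ`, a profinite space with property (K)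
of density `μ`. This is done by induction on `μ`.

At a limit cardinal `μ`, take the product of spaces whose densities run through the successors
below `μ`, with at most `2 ^ μ` factors. The density does not exceed `μ` by the
Hewitt–Marczewski–Pondiczery theorem, and property (K) passes to products by the Δ-system lemma.

For the step from `κ` to `κ⁺`, let `X` be the space of density `κ`. An array `s` of nonempty clopen
sets of `X`, indexed by pairs from `Ω = κ⁺`, is read as a list of constraints: the point `v` placed
at the node of `(α, β, s ↾ β)` should lie in `s β α`. The new space consists of the pairs of an
assignment `v` of points to nodes and, for each `s`, a subset of `Ω` between whose members
`α < β` all constraints of `s` hold.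

* Two arrays first differ in at most one row. Outside the finitely many rows where two members of a
  given finite set of arrays first differ, this set imposes at most one constraint on each node, and
  it can be met since the entries are nonempty. Hence configurations that agree on their common
  coordinates amalgamate, which gives property (K). Similarly the configurations with finite
  selections are dense, and the density is at most `κ⁺`.
* Let `D` be a set of at most `κ` configurations, ranked by ordinals below `κ`. Since any fewer than
  `κ` points of `X` miss a nonempty clopen set, one can choose `s` by recursion on rows so that
  `s β α` avoids the points at its node of all members of `D` of rank at most `e β α`, where each
  `e β` embeds `β` into `κ`. If `D` were dense, each `α < κ⁺` would be selected for `s` by some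
  member of `D`, and `κ⁺` many of them by the same one, say of rank `k`. Some two of these, `α < β`,
  have `e β α ≥ k`, and then the constraint `s β α` is both met and avoided.
-/

open Cardinal Set TopologicalSpace

section Cliques

variable {ι E : Type*}

/-- Every uncountable set contains an uncountable clique of the relation `r`: the common shape of
the refinement steps in a proof of property (K). -/
def HasUncountableCliques (r : ι → ι → Prop) : Prop :=
  ∀ I : Set ι, ¬ I.Countable → ∃ J ⊆ I, ¬ J.Countable ∧ J.Pairwise r

theorem HasUncountableCliques.mono {r s : ι → ι → Prop} (hr : HasUncountableCliques r)
    (h : ∀ i j, r i j → s i j) : HasUncountableCliques s := fun I hI =>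
  let ⟨J, hJI, hJ, hrJ⟩ := hr I hI
  ⟨J, hJI, hJ, hrJ.mono' h⟩

theorem HasUncountableCliques.and {r s : ι → ι → Prop} (hr : HasUncountableCliques r)
    (hs : HasUncountableCliques s) : HasUncountableCliques fun i j => r i j ∧ s i j := by
  intro I hI
  obtain ⟨J, hJI, hJ, hrJ⟩ := hr I hI
  obtain ⟨K, hKJ, hK, hsK⟩ := hs J hJ
  exact ⟨K, hKJ.trans hJI, hK, fun i hi j hj hij =>
    ⟨hrJ (hKJ hi) (hKJ hj) hij, hsK hi hj hij⟩⟩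

theorem HasUncountableCliques.forall_mem_finset {r : E → ι → ι → Prop}
    (hr : ∀ e, HasUncountableCliques (r e)) (R : Finset E) :
    HasUncountableCliques fun i j => ∀ e ∈ R, r e i j := by
  classical
  induction R using Finset.induction_on with
  | empty => exact fun I hI => ⟨I, Subset.rfl, hI, fun i _ j _ _ => by simp⟩
  | insert e R _ ih => exact ((hr e).and ih).mono fun i j h => by simpa using h

theorem exists_uncountable_fiber {β : Type*} [Countable β] (f : ι → β) {I : Set ι}
    (hI : ¬ I.Countable) : ∃ b, ¬ {i ∈ I | f i = b}.Countable := by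
  by_contra! h
  refine hI ((countable_iUnion h).mono fun i hi => ?_)
  exact mem_iUnion.2 ⟨f i, hi, rfl⟩

theorem hasUncountableCliques_map_eq {β : Type*} [Countable β] (f : ι → β) :
    HasUncountableCliques fun i j => f i = f j := by
  intro I hI
  obtain ⟨b, hb⟩ := exists_uncountable_fiber f hI
  exact ⟨{i ∈ I | f i = b}, fun i hi => hi.1, hb, fun i hi j hj _ => hi.2.trans hj.2.symm⟩

theorem exists_uncountable_clique {r : ι → ι → Prop} [Std.Symm r] {I : Set ι}
    (hI : ¬ I.Countable) (h : ∀ i ∈ I, {j ∈ I | ¬ r i j}.Countable) :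
    ∃ J ⊆ I, ¬ J.Countable ∧ J.Pairwise r := by
  obtain ⟨J, hJ⟩ : ∃ J, Maximal (· ∈ {J : Set ι | J ⊆ I ∧ J.Pairwise r}) J := by
    refine zorn_subset _ fun c hc hchain => ⟨⋃₀ c, ?_, fun s hs => subset_sUnion_of_mem hs⟩
    exact ⟨sUnion_subset fun s hs => (hc hs).1,
      (pairwise_sUnion hchain.directedOn).2 fun s hs => (hc hs).2⟩
  refine ⟨J, hJ.prop.1, fun hJc => hI ?_, hJ.prop.2⟩
  refine (hJc.union (hJc.biUnion fun i hi => h i (hJ.prop.1 hi))).mono fun j hj => ?_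
  by_contra hjJ
  simp only [mem_union, mem_iUnion, mem_ofPred_eq, not_or, not_exists, not_and, not_not] at hjJ
  have hins : (insert j J).Pairwise r := pairwise_insert_of_symm.2
    ⟨hJ.prop.2, fun i hi _ => symm_of r (hjJ.2 i hi hj)⟩
  exact hjJ.1 (hJ.le_of_ge ⟨insert_subset hj hJ.prop.1, hins⟩ (subset_insert j J)
    (mem_insert j J))

theorem exists_uncountable_pairwise_disjoint (F : ι → Finset E) {I : Set ι} (hI : ¬ I.Countable)
    (h : ∀ e, {i ∈ I | e ∈ F i}.Countable) :
    ∃ J ⊆ I, ¬ J.Countable ∧ J.Pairwise fun i j => Disjoint (F i) (F j) := by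
  have : Std.Symm fun i j => Disjoint (F i) (F j) := ⟨fun _ _ h => h.symm⟩
  refine exists_uncountable_clique hI fun i _ => ?_
  refine ((F i).countable_toSet.biUnion fun e _ => h e).mono fun j hj => ?_
  obtain ⟨e, hei, hej⟩ := Finset.not_disjoint_iff.1 hj.2
  exact mem_biUnion hei ⟨hj.1, hej⟩

variable [DecidableEq E]

theorem exists_deltaSystem_of_card_eq (n : ℕ) (F : ι → Finset E) {I : Set ι}
    (hI : ¬ I.Countable) (hn : ∀ i ∈ I, (F i).card = n) :
    ∃ J ⊆ I, ¬ J.Countable ∧ ∃ R, J.Pairwise fun i j => F i ∩ F j = R := by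
  induction n generalizing F I with
  | zero =>
    exact ⟨I, Subset.rfl, hI, ∅, fun i hi j _ _ => by
      simp only [Finset.card_eq_zero.1 (hn i hi), Finset.empty_inter]⟩
  | succ n ih =>
    by_cases! h : ∃ e, ¬ {i ∈ I | e ∈ F i}.Countable
    · obtain ⟨e, he⟩ := h
      obtain ⟨J, hJI, hJ, R, hR⟩ := ih (fun i => (F i).erase e) he fun i hi => by
        rw [Finset.card_erase_of_mem hi.2, hn i hi.1, Nat.add_sub_cancel]
      refine ⟨J, fun i hi => (hJI hi).1, hJ, insert e R, fun i hi j hj hij => ?_⟩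
      have heij : e ∈ F i ∩ F j := Finset.mem_inter.2 ⟨(hJI hi).2, (hJI hj).2⟩
      have herase : (F i ∩ F j).erase e = R := by
        rw [← hR hi hj hij, Finset.erase_inter, Finset.inter_erase, Finset.erase_idem]
      exact herase ▸ (Finset.insert_erase heij).symm
    · obtain ⟨J, hJI, hJ, hdisj⟩ := exists_uncountable_pairwise_disjoint F hI h
      exact ⟨J, hJI, hJ, ∅, hdisj.mono' fun i j => Finset.disjoint_iff_inter_eq_empty.1⟩

theorem exists_deltaSystem (F : ι → Finset E) {I : Set ι} (hI : ¬ I.Countable) :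
    ∃ J ⊆ I, ¬ J.Countable ∧ ∃ R, J.Pairwise fun i j => F i ∩ F j = R := by
  obtain ⟨n, hn⟩ := exists_uncountable_fiber (fun i => (F i).card) hI
  obtain ⟨J, hJI, hJ⟩ := exists_deltaSystem_of_card_eq n F hn fun i hi => hi.2
  exact ⟨J, hJI.trans (sep_subset _ _), hJ⟩

theorem HasUncountableCliques.forall_mem_inter (F : ι → Finset E) {r : E → ι → ι → Prop}
    (hr : ∀ e, HasUncountableCliques (r e)) :
    HasUncountableCliques fun i j => ∀ e ∈ F i ∩ F j, r e i j := by
  intro I hI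
  obtain ⟨J, hJI, hJ, R, hR⟩ := exists_deltaSystem F hI
  obtain ⟨K, hKJ, hK, hrK⟩ := HasUncountableCliques.forall_mem_finset hr R J hJ
  refine ⟨K, hKJ.trans hJI, hK, fun i hi j hj hij => ?_⟩
  simpa only [hR (hKJ hi) (hKJ hj) hij] using hrK hi hj hij

end Cliques

section PropertyK

/-- Property (K) of a topological space: every uncountable family of nonempty open sets has an
uncountable subfamily any two members of which meet. Unlike the countable chain condition, it
passes to products. -/
def PropertyK (X : Type u) [TopologicalSpace X] : Prop :=
  ∀ (ι : Type u) (W : ι → Set X), (∀ i, IsOpen (W i)) → (∀ i, (W i).Nonempty) →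
    HasUncountableCliques fun i j => (W i ∩ W j).Nonempty

theorem propertyK_of_separableSpace (X : Type u) [TopologicalSpace X] [SeparableSpace X] :
    PropertyK X := by
  intro ι W hWo hWne
  obtain ⟨D, hDc, hD⟩ := exists_countable_dense X
  choose x hxD hxW using fun i => hD.exists_mem_open (hWo i) (hWne i)
  have : Countable D := hDc.to_subtype
  refine (hasUncountableCliques_map_eq fun i => (⟨x i, hxD i⟩ : D)).mono fun i j hij => ?_
  exact ⟨x i, hxW i, by rw [Subtype.mk.inj hij]; exact hxW j⟩

theorem exists_isOpen_finset_pi_subset {T : Type*} {X : T → Type*} [∀ t, TopologicalSpace (X t)]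
    {W : Set (∀ t, X t)} (hW : IsOpen W) {z : ∀ t, X t} (hz : z ∈ W) :
    ∃ (Q : Finset T) (O : ∀ t, Set (X t)), (∀ t, IsOpen (O t)) ∧ (∀ t, z t ∈ O t) ∧
      (Q : Set T).pi O ⊆ W := by
  classical
  obtain ⟨Q, O, hO, hQW⟩ := isOpen_pi_iff.1 hW z hz
  refine ⟨Q, fun t => if t ∈ Q then O t else univ, fun t => ?_, fun t => ?_, ?_⟩
  · beta_reduce
    split_ifs with ht
    exacts [(hO t ht).1, isOpen_univ]
  · beta_reduce
    split_ifs with ht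
    exacts [(hO t ht).2, mem_univ _]
  · exact fun w hw => hQW fun t ht => by simpa only [if_pos (Finset.mem_coe.1 ht)] using hw t ht

theorem PropertyK.pi {T : Type u} {X : T → Type u} [∀ t, TopologicalSpace (X t)]
    (hX : ∀ t, PropertyK (X t)) : PropertyK (∀ t, X t) := by
  classical
  intro ι W hWo hWne
  choose z hz using hWne
  choose Q O hO hzO hQW using fun i => exists_isOpen_finset_pi_subset (hWo i) (hz i)
  refine (HasUncountableCliques.forall_mem_inter Q fun t => hX t ι (fun i => O i t)
    (fun i => hO i t) fun i => ⟨z i t, hzO i t⟩).mono fun i j hij => ?_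
  have hcoord : ∀ t, ∃ x : X t, (t ∈ Q i → x ∈ O i t) ∧ (t ∈ Q j → x ∈ O j t) := by
    intro t
    by_cases hti : t ∈ Q i
    · by_cases htj : t ∈ Q j
      · obtain ⟨x, hxi, hxj⟩ := hij t (Finset.mem_inter.2 ⟨hti, htj⟩)
        exact ⟨x, fun _ => hxi, fun _ => hxj⟩
      · exact ⟨z i t, fun _ => hzO i t, fun h => absurd h htj⟩
    · exact ⟨z j t, fun h => absurd h hti, fun _ => hzO j t⟩
  choose x hxi hxj using hcoord
  exact ⟨x, hQW i fun t => hxi t, hQW j fun t => hxj t⟩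

end PropertyK

section Density

theorem mk_fun_le_two_power {A B : Type u} {κ : Cardinal.{u}} (hκ : ℵ₀ ≤ κ) (hA : #A ≤ κ)
    (hB : #B ≤ 2 ^ κ) : #(A → B) ≤ 2 ^ κ :=
  calc #(A → B) = #B ^ #A := (power_def B A).symm
    _ ≤ (2 ^ κ) ^ #A := power_le_power_right hB
    _ ≤ (2 ^ κ) ^ κ := power_le_power_left (power_ne_zero κ two_ne_zero) hA
    _ = 2 ^ κ := by rw [← power_mul, mul_eq_self hκ]

variable {X Y : Type u} [TopologicalSpace X] [TopologicalSpace Y]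

/-- The density of a topological space: the least cardinality of a dense subset. -/
noncomputable def density (X : Type u) [TopologicalSpace X] : Cardinal.{u} :=
  ⨅ D : {D : Set X // Dense D}, #D

theorem density_le_of_dense {D : Set X} (hD : Dense D) : density X ≤ #D :=
  ciInf_le' (fun D : {D : Set X // Dense D} => #D) ⟨D, hD⟩

theorem exists_dense_mk_eq_density (X : Type u) [TopologicalSpace X] :
    ∃ D : Set X, Dense D ∧ #D = density X := by
  have : Nonempty {D : Set X // Dense D} := ⟨univ, dense_univ⟩
  obtain ⟨D, hD⟩ := ciInf_mem fun D : {D : Set X // Dense D} => #D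
  exact ⟨D, D.2, hD⟩

theorem density_le_of_denseRange {ι : Type u} {f : ι → X} (hf : DenseRange f) :
    density X ≤ #ι :=
  (density_le_of_dense hf).trans mk_range_le

theorem exists_denseRange_of_density_le [Nonempty X] {ι : Type u} (h : density X ≤ #ι) :
    ∃ f : ι → X, DenseRange f := by
  obtain ⟨D, hD, hDX⟩ := exists_dense_mk_eq_density X
  obtain ⟨e⟩ : Nonempty (D ↪ ι) := by rwa [← hDX] at h
  have : Nonempty D := hD.nonempty.to_subtype
  exact ⟨Subtype.val ∘ Function.invFun e,
    hD.denseRange_val.comp (Function.invFun_surjective e.injective).denseRange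
      continuous_subtype_val⟩

theorem density_le_density_of_denseRange {f : X → Y} (hf : DenseRange f) (hfc : Continuous f) :
    density Y ≤ density X := by
  obtain ⟨D, hD, hDX⟩ := exists_dense_mk_eq_density X
  exact (density_le_of_dense (hf.dense_image hfc hD)).trans (mk_image_le.trans_eq hDX)

theorem density_of_isEmpty [IsEmpty X] : density X = 0 := by
  simpa using density_le_of_dense (dense_univ (X := X))

theorem nonempty_of_density_ne_zero (h : density X ≠ 0) : Nonempty X := by
  by_contra! hX
  exact h density_of_isEmpty

theorem density_of_discreteTopology [DiscreteTopology X] : density X = #X := by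
  obtain ⟨D, hD, hDX⟩ := exists_dense_mk_eq_density X
  rw [← hDX, dense_discrete.1 hD, mk_univ]

theorem density_prod_le : density (X × Y) ≤ density X * density Y := by
  obtain ⟨D, hD, hDX⟩ := exists_dense_mk_eq_density X
  obtain ⟨E, hE, hEY⟩ := exists_dense_mk_eq_density Y
  rw [← hDX, ← hEY, ← mk_setProd]
  exact density_le_of_dense (hD.prod hE)

theorem mk_clopens_le_two_power_density : #(Clopens X) ≤ 2 ^ density X := by
  obtain ⟨D, hD, hDX⟩ := exists_dense_mk_eq_density X
  have hclosure (a : Clopens X) : closure (↑a ∩ D) = (a : Set X) :=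
    (closure_minimal inter_subset_left a.isClopen.1).antisymm
      (hD.open_subset_closure_inter a.isClopen.2)
  have hinj : Function.Injective fun a : Clopens X => {d : D | ↑d ∈ (a : Set X)} := by
    intro a b hab
    have htrace : (a : Set X) ∩ D = ↑b ∩ D := by
      rw [inter_comm, ← Subtype.image_preimage_coe, inter_comm, ← Subtype.image_preimage_coe]
      exact congrArg (Subtype.val '' ·) hab
    exact SetLike.coe_injective (by rw [← hclosure a, ← hclosure b, htrace])
  simpa only [mk_set, hDX] using mk_le_of_injective hinj

theorem exists_clopens_disjoint_of_mk_lt_density [CompactSpace X] [T2Space X]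
    [TotallyDisconnectedSpace X] {D : Set X} (hD : #D < density X) :
    ∃ a : Clopens X, (a : Set X).Nonempty ∧ Disjoint (a : Set X) D := by
  have hDd : (closure D)ᶜ.Nonempty := by
    rw [nonempty_compl, Ne, ← dense_iff_closure_eq]
    exact fun h => (density_le_of_dense h).not_gt hD
  obtain ⟨x, hx⟩ := hDd
  obtain ⟨a, ha, hxa, haD⟩ :=
    isTopologicalBasis_isClopen.exists_subset_of_mem_open hx isClosed_closure.isOpen_compl
  exact ⟨⟨a, ha⟩, ⟨x, hxa⟩, disjoint_left.2 fun y hya hyD => haD hya (subset_closure hyD)⟩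

theorem exists_mvPolynomial_eval_eq {K σ T : Type*} [Field K] {r : T → σ → K}
    (hr : Function.Injective r) (F : Finset T) (h : T → K) :
    ∃ p : MvPolynomial σ K, ∀ t ∈ F, MvPolynomial.eval (r t) p = h t := by
  classical
  have hpair (t t' : T) (htt' : t ≠ t') : ∃ q : MvPolynomial σ K,
      MvPolynomial.eval (r t) q = 1 ∧ MvPolynomial.eval (r t') q = 0 := by
    obtain ⟨k, hk⟩ := Function.ne_iff.1 (hr.ne htt')
    refine ⟨.C (r t k - r t' k)⁻¹ * (.X k - .C (r t' k)), ?_, by simp⟩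
    simpa using inv_mul_cancel₀ (sub_ne_zero.2 hk)
  choose! q hq_one hq_zero using hpair
  refine ⟨∑ t ∈ F, .C (h t) * ∏ t' ∈ F.erase t, q t t', fun t ht => ?_⟩
  simp only [map_sum, map_mul, map_prod, MvPolynomial.eval_C]
  rw [Finset.sum_eq_single_of_mem t ht, Finset.prod_eq_one, mul_one]
  · exact fun t' ht' => hq_one t t' (Finset.ne_of_mem_erase ht').symm
  · intro s _ hst
    rw [Finset.prod_eq_zero (Finset.mem_erase.2 ⟨hst.symm, ht⟩) (hq_zero s t hst), mul_zero]

theorem density_fun_le {K T : Type u} [Infinite K] [TopologicalSpace K] (hT : #T ≤ 2 ^ #K) :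
    density (T → K) ≤ #K := by
  -- Over a field structure on `K`, the evaluations of the `#K` polynomials in `K` variables at
  -- distinct points interpolate arbitrary finite data.
  obtain ⟨hfield⟩ := Infinite.nonempty_field (α := K)
  obtain ⟨e⟩ : Nonempty (T ↪ Set K) := by rwa [← mk_set] at hT
  let r (t : T) : K → K := (e t).indicator 1
  have hr : Function.Injective r := fun t t' h => e.injective (indicator_one_inj K h)
  have hdense : DenseRange fun (p : MvPolynomial K K) t => MvPolynomial.eval (r t) p := by
    refine dense_iff_inter_open.2 fun W hW ⟨z, hz⟩ => ?_
    obtain ⟨Q, O, -, hzO, hQW⟩ := exists_isOpen_finset_pi_subset hW hz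
    obtain ⟨p, hp⟩ := exists_mvPolynomial_eval_eq hr Q z
    exact ⟨_, hQW fun t ht => by simpa only [hp t ht] using hzO t, p, rfl⟩
  refine (density_le_of_denseRange hdense).trans ?_
  simpa only [max_self, max_eq_left (aleph0_le_mk K)] using
    MvPolynomial.cardinalMk_le_max (σ := K) (R := K)

/-- The Hewitt–Marczewski–Pondiczery theorem. -/
theorem density_pi_le {T : Type u} {X : T → Type u} [∀ t, TopologicalSpace (X t)]
    {κ : Cardinal.{u}} (hκ : ℵ₀ ≤ κ) (hT : #T ≤ 2 ^ κ) (hX : ∀ t, density (X t) ≤ κ) :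
    density (∀ t, X t) ≤ κ := by
  cases isEmpty_or_nonempty (∀ t, X t)
  · simp only [density_of_isEmpty, zero_le]
  have hne (t : T) : Nonempty (X t) := ‹Nonempty (∀ t, X t)›.map (· t)
  induction κ using Cardinal.inductionOn with | _ K
  have : Infinite K := infinite_iff.2 hκ
  let _ : TopologicalSpace K := ⊥
  have : DiscreteTopology K := ⟨rfl⟩
  choose f hf using fun t => exists_denseRange_of_density_le (hX t)
  exact (density_le_density_of_denseRange (DenseRange.piMap hf)
    (Continuous.piMap fun t => continuous_of_discreteTopology)).trans (density_fun_le hT)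

end Density

theorem exists_eqOn_eqOn {P Y : Type*} {f g : P → Y} {F G : Set P} (h : EqOn f g (F ∩ G)) (c : Y) :
    ∃ k, EqOn k f F ∧ EqOn k g G ∧ ∀ p ∉ F ∪ G, k p = c := by
  classical
  refine ⟨F.piecewise f (G.piecewise g fun _ => c), piecewise_eqOn _ _ _, fun p hG => ?_,
    fun p hp => ?_⟩
  · by_cases hF : p ∈ F
    · rw [piecewise_eq_of_mem _ _ _ hF, h ⟨hF, hG⟩]
    · rw [piecewise_eq_of_notMem _ _ _ hF, piecewise_eq_of_mem _ _ _ hG]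
  · rw [mem_union, not_or] at hp
    rw [piecewise_eq_of_notMem _ _ _ hp.1, piecewise_eq_of_notMem _ _ _ hp.2]

theorem exists_injOn_of_mk_le {Ω K : Type u} [Nonempty K] {S : Set Ω} (h : #S ≤ #K) :
    ∃ f : Ω → K, InjOn f S := by
  obtain ⟨e⟩ := h
  let f : Ω → K := Function.extend Subtype.val e fun _ => Classical.arbitrary K
  have hf (a : S) : f a = e a := Subtype.val_injective.extend_apply _ _ a
  refine ⟨f, fun a ha b hb hab => congrArg Subtype.val (e.injective (?_ : e ⟨a, ha⟩ = e ⟨b, hb⟩))⟩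
  rw [← hf, ← hf, hab]

theorem exists_lt_map_eq_lt {Ω K : Type u} [LinearOrder Ω] [LinearOrder K] [Infinite K]
    (hK : ∀ k : K, #(Iic k) < #K) (hKΩ : #K < #Ω) (hΩ : ∀ β : Ω, #(Iic β) ≤ #K)
    {e : Ω → Ω → K} (he : ∀ β, InjOn (e β) (Iic β)) (c : Ω → K) :
    ∃ α β, α < β ∧ c α = c β ∧ c β < e β α := by
  have hKinf := aleph0_le_mk K
  obtain ⟨k, hk⟩ := infinite_pigeonhole_card_lt c hKΩ (hKinf.trans hKΩ.le)
  obtain ⟨Z, hZk, hZ⟩ := le_mk_iff_exists_subset.1 hk.le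
  obtain ⟨β, hβk, hβ⟩ : ∃ β ∈ c ⁻¹' {k}, β ∉ ⋃ ζ ∈ Z, Iic ζ := by
    refine not_subset.1 fun hsub => hk.not_ge ((mk_le_mk_of_subset hsub).trans ?_)
    exact (mk_biUnion_le _ _).trans
      (mul_le_of_le hKinf hZ.le (ciSup_le' fun ζ => hΩ ζ))
  have hZβ (α) (hα : α ∈ Z) : α < β := by
    by_contra! h
    exact hβ (mem_biUnion hα h)
  obtain ⟨α, hα, hαk⟩ : ∃ α ∈ Z, e β α ∉ Iic k := by
    by_contra! h
    have hinj : InjOn (e β) Z := (he β).mono fun α hα => (hZβ α hα).le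
    refine (hK k).not_ge ?_
    calc #K = #(e β '' Z) := by rw [mk_image_eq_of_injOn _ _ hinj, hZ]
      _ ≤ #(Iic k) := mk_le_mk_of_subset (image_subset_iff.2 h)
  exact ⟨α, β, hZβ α hα, (hZk hα).trans hβk.symm, hβk.symm ▸ not_le.1 hαk⟩

/-- The nonempty clopen sets of a space. -/
abbrev NonemptyClopens (X : Type u) [TopologicalSpace X] : Type u :=
  {a : Clopens X // (a : Set X).Nonempty}

theorem mk_nonemptyClopens_le_two_power {X : Type u} [TopologicalSpace X] {κ : Cardinal.{u}}
    (h : density X ≤ κ) : #(NonemptyClopens X) ≤ 2 ^ κ :=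
  (mk_subtype_le _).trans <| mk_clopens_le_two_power_density.trans <|
    power_le_power_left two_ne_zero h

/-- A square array of nonempty clopen sets, with row `β` and column `α` of `s` holding `s β α`. The
clopen set `s β α` is a constraint on the point chosen at the node `node α β s`. -/
abbrev ClopenArray (Ω X : Type u) [TopologicalSpace X] : Type u := Ω → Ω → NonemptyClopens X

theorem mk_clopenArray_le {Ω X : Type u} [TopologicalSpace X] [Infinite Ω] (h : density X ≤ #Ω) :
    #(ClopenArray Ω X) ≤ 2 ^ #Ω := by
  have hΩ := aleph0_le_mk Ω
  exact mk_fun_le_two_power hΩ le_rfl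
    (mk_fun_le_two_power hΩ le_rfl (mk_nonemptyClopens_le_two_power h))

namespace ClopenArray

variable {Ω X : Type u} [LinearOrder Ω] [TopologicalSpace X]

/-- A node is a column `α`, a row `β`, and the part of a clopen array above row `β`: a constraint
on the point at a node must be chosen knowing the earlier rows only. -/
abbrev Node (Ω X : Type u) [LinearOrder Ω] [TopologicalSpace X] : Type u :=
  Ω × Σ β : Ω, (Iio β → Ω → NonemptyClopens X)

/-- The node at column `α` and row `β` of the array `s`. -/
def node (α β : Ω) (s : ClopenArray Ω X) : Node Ω X := (α, ⟨β, fun γ => s γ⟩)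

/-- The nodes with column and row in `S`. -/
def nodesOver (S : Set Ω) : Set (Node Ω X) := {q | q.1 ∈ S ∧ q.2.1 ∈ S}

theorem node_eq_node {α β α' β' : Ω} {s t : ClopenArray Ω X} (h : node α β s = node α' β' t) :
    α = α' ∧ β = β' ∧ EqOn s t (Iio β) := by
  simp only [node, Prod.mk.injEq, Sigma.mk.injEq] at h
  obtain ⟨rfl, rfl, h⟩ := h
  exact ⟨rfl, rfl, fun γ hγ => congrFun (eq_of_heq h) ⟨γ, hγ⟩⟩

theorem exists_forall_node {R : Node Ω X → NonemptyClopens X → Prop} [WellFoundedLT Ω]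
    (hR : ∀ q, ∃ a, R q a) : ∃ s : ClopenArray Ω X, ∀ α β, R (node α β s) (s β α) := by
  choose F hF using hR
  let s : ClopenArray Ω X := wellFounded_lt.fix fun β ih α => F (α, ⟨β, fun γ => ih γ γ.2⟩)
  have hs (α β : Ω) : s β α = F (node α β s) := by
    rw [show s β = _ from wellFounded_lt.fix_eq _ β]
    rfl
  exact ⟨s, fun α β => hs α β ▸ hF _⟩

/-- An assignment of points to nodes together with, for each array, a selection of indices. -/
abbrev Configuration (Ω X : Type u) [LinearOrder Ω] [TopologicalSpace X] : Type u :=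
  (Node Ω X → X) × (ClopenArray Ω X × Ω → Bool)

/-- The set of indices which the predicate `y` selects for the array `s`. -/
def selected (y : ClopenArray Ω X × Ω → Bool) (s : ClopenArray Ω X) : Set Ω :=
  {α | y (s, α) = true}

theorem isOpen_setOf_mem_selected (s : ClopenArray Ω X) (α : Ω) :
    IsOpen {z : Configuration Ω X | α ∈ selected z.2 s} := by
  have hcont : Continuous fun z : Configuration Ω X => z.2 (s, α) :=
    (continuous_apply _).comp continuous_snd
  exact hcont.isOpen_preimage {true} (isOpen_discrete _)

/-- The assignment `v` of points to nodes meets the constraints of `s` at all pairs `α < β` from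
`T`. -/
def Satisfies (v : Node Ω X → X) (s : ClopenArray Ω X) (T : Set Ω) : Prop :=
  ∀ α ∈ T, ∀ β ∈ T, α < β → v (node α β s) ∈ (s β α).1

theorem Satisfies.mono {v : Node Ω X → X} {s : ClopenArray Ω X} {T T' : Set Ω}
    (h : Satisfies v s T) (hT : T' ⊆ T) : Satisfies v s T' :=
  fun α hα β hβ => h α (hT hα) β (hT hβ)

theorem isClopen_setOf_satisfies (s : ClopenArray Ω X) {T : Set Ω} (hT : T.Finite) :
    IsClopen {v | Satisfies v s T} := by
  have hrepr : {v : Node Ω X → X | Satisfies v s T} =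
      ⋂ α ∈ T, ⋂ β ∈ T, ⋂ (_ : α < β), (· (node α β s)) ⁻¹' ((s β α).1 : Set X) := by
    ext v
    simp only [Satisfies, mem_ofPred_eq, mem_iInter, mem_preimage, SetLike.mem_coe]
  rw [hrepr]
  exact hT.isClopen_biInter fun α _ => hT.isClopen_biInter fun β _ =>
    isClopen_iInter_of_finite fun _ => (s β α).1.isClopen.preimage (continuous_apply _)

theorem dependsOn_satisfies (s : ClopenArray Ω X) (S : Set Ω) :
    DependsOn (Satisfies · s S) (nodesOver S) := by
  intro v w hvw
  have hnode (α β : Ω) (hα : α ∈ S) (hβ : β ∈ S) : v (node α β s) = w (node α β s) :=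
    hvw _ ⟨hα, hβ⟩
  simp +contextual only [Satisfies, hnode]

/-- The configurations in which every constraint between selected indices is met. -/
def constraintSet (Ω X : Type u) [LinearOrder Ω] [TopologicalSpace X] : Set (Configuration Ω X) :=
  {z | ∀ s, Satisfies z.1 s (selected z.2 s)}

theorem isClosed_constraintSet : IsClosed (constraintSet Ω X) := by
  have hrepr : constraintSet Ω X = ⋂ (s) (α) (β) (_ : α < β),
      {z | α ∈ selected z.2 s → β ∈ selected z.2 s → z.1 (node α β s) ∈ (s β α).1} := by
    ext z
    simp only [constraintSet, Satisfies, mem_ofPred_eq, mem_iInter]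
    exact forall₂_congr fun s α => ⟨fun h β hαβ hα hβ => h hα β hβ hαβ,
      fun h hα β hβ hαβ => h β hαβ hα hβ⟩
  rw [hrepr]
  refine isClosed_iInter fun s => isClosed_iInter fun α => isClosed_iInter fun β =>
    isClosed_iInter fun _ => isClosed_imp (isOpen_setOf_mem_selected s α)
      (isClosed_imp (isOpen_setOf_mem_selected s β) ?_)
  exact (s β α).1.isClopen.isClosed.preimage ((continuous_apply _).comp continuous_fst)

/-- Two arrays of `A` which agree above a row outside `S` agree on that row too, so that `A`
imposes at most one constraint on a node in such a row. -/
def Separates (S : Set Ω) (A : Set (ClopenArray Ω X)) : Prop :=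
  ∀ s ∈ A, ∀ t ∈ A, ∀ β ∉ S, EqOn s t (Iio β) → s β = t β

theorem exists_finset_separates (S₀ : Finset Ω) (A : Finset (ClopenArray Ω X)) :
    ∃ S : Finset Ω, S₀ ⊆ S ∧ Separates (S : Set Ω) (A : Set (ClopenArray Ω X)) := by
  let firstDiff (s t : ClopenArray Ω X) : Set Ω := {β | EqOn s t (Iio β) ∧ s β ≠ t β}
  have hsub (s t) : (firstDiff s t).Subsingleton := by
    rintro β ⟨hβ, hβne⟩ γ ⟨hγ, hγne⟩
    by_contra hne
    exact (Ne.lt_or_gt hne).elim (fun h => hβne (hγ h)) fun h => hγne (hβ h)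
  have hfin : (S₀ ∪ ⋃ s ∈ A, ⋃ t ∈ A, firstDiff s t : Set Ω).Finite :=
    S₀.finite_toSet.union <| A.finite_toSet.biUnion fun s _ =>
      A.finite_toSet.biUnion fun t _ => (hsub s t).finite
  refine ⟨hfin.toFinset, fun α hα => hfin.mem_toFinset.2 (.inl hα), fun s hs t ht β hβ heq => ?_⟩
  by_contra hne
  refine hβ (hfin.mem_toFinset.2 (.inr ?_))
  exact mem_biUnion hs (mem_biUnion ht ⟨heq, hne⟩)

theorem Separates.exists_assignment {S : Set Ω} {A : Set (ClopenArray Ω X)} (h : Separates S A)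
    (N : Set (Node Ω X)) (v : Node Ω X → X) : ∃ w, EqOn w v N ∧
      ∀ s ∈ A, ∀ α, ∀ β ∉ S, node α β s ∉ N → w (node α β s) ∈ (s β α).1 := by
  have hpoint (q : Node Ω X) : ∃ x, (q ∈ N → x = v q) ∧
      ∀ s ∈ A, ∀ α, ∀ β ∉ S, q = node α β s → q ∉ N → x ∈ (s β α).1 := by
    by_cases hq : (∃ s ∈ A, ∃ α, ∃ β ∉ S, q = node α β s) ∧ q ∉ N
    · obtain ⟨⟨s, hs, α, β, hβ, rfl⟩, hN⟩ := hq
      obtain ⟨x, hx⟩ := (s β α).2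
      refine ⟨x, fun h => absurd h hN, fun t ht α' β' hβ' heq _ => ?_⟩
      obtain ⟨rfl, rfl, hst⟩ := node_eq_node heq
      exact h s hs t ht β hβ hst ▸ hx
    · exact ⟨v q, fun _ => rfl, fun s hs α β hβ heq hN =>
        absurd ⟨⟨s, hs, α, β, hβ, heq⟩, hN⟩ hq⟩
  choose w hwN hw using hpoint
  exact ⟨w, hwN, fun s hs α β hβ => hw _ s hs α β hβ rfl⟩

theorem Separates.inter {S₁ S₂ : Set Ω} {A₁ A₂ : Set (ClopenArray Ω X)} (h₁ : Separates S₁ A₁)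
    (h₂ : Separates S₂ A₂) : Separates (S₁ ∩ S₂) (A₁ ∩ A₂) := by
  intro s hs t ht β hβ heq
  by_cases hβ₁ : β ∈ S₁
  · exact h₂ s hs.2 t ht.2 β (fun hβ₂ => hβ ⟨hβ₁, hβ₂⟩) heq
  · exact h₁ s hs.1 t ht.1 β hβ₁ heq

theorem exists_amalgam {S₁ S₂ : Set Ω} {A₁ A₂ : Set (ClopenArray Ω X)} (h₁ : Separates S₁ A₁)
    (h₂ : Separates S₂ A₂) {v : Node Ω X → X} {y₁ y₂ : ClopenArray Ω X × Ω → Bool}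
    (hv₁ : ∀ s ∈ A₁, Satisfies v s (S₁ ∩ selected y₁ s))
    (hv₂ : ∀ s ∈ A₂, Satisfies v s (S₂ ∩ selected y₂ s))
    (hy : EqOn y₁ y₂ (A₁ ×ˢ S₁ ∩ A₂ ×ˢ S₂)) :
    ∃ z ∈ constraintSet Ω X, EqOn z.1 v (nodesOver S₁ ∪ nodesOver S₂) ∧
      EqOn z.2 y₁ (A₁ ×ˢ S₁) ∧ EqOn z.2 y₂ (A₂ ×ˢ S₂) := by
  obtain ⟨w, hwv, hw⟩ := (h₁.inter h₂).exists_assignment (nodesOver S₁ ∪ nodesOver S₂) v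
  obtain ⟨y, hy₁, hy₂, hyfalse⟩ := exists_eqOn_eqOn hy false
  have hysupp (p) (hp : y p = true) : p ∈ A₁ ×ˢ S₁ ∨ p ∈ A₂ ×ˢ S₂ := by
    by_contra h
    exact Bool.false_ne_true ((hyfalse p h).symm.trans hp)
  refine ⟨(w, y), fun s α hα β hβ hαβ => ?_, hwv, hy₁, hy₂⟩
  have hin₁ (hs : s ∈ A₁) (h : α ∈ S₁ ∧ β ∈ S₁) : w (node α β s) ∈ (s β α).1 := by
    rw [hwv (.inl h)]
    exact hv₁ s hs α ⟨h.1, (hy₁ ⟨hs, h.1⟩).symm.trans hα⟩ β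
      ⟨h.2, (hy₁ ⟨hs, h.2⟩).symm.trans hβ⟩ hαβ
  have hin₂ (hs : s ∈ A₂) (h : α ∈ S₂ ∧ β ∈ S₂) : w (node α β s) ∈ (s β α).1 := by
    rw [hwv (.inr h)]
    exact hv₂ s hs α ⟨h.1, (hy₂ ⟨hs, h.1⟩).symm.trans hα⟩ β
      ⟨h.2, (hy₂ ⟨hs, h.2⟩).symm.trans hβ⟩ hαβ
  have hboth (hs : s ∈ A₁ ∩ A₂) : w (node α β s) ∈ (s β α).1 := by
    by_cases hαβ₁ : α ∈ S₁ ∧ β ∈ S₁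
    · exact hin₁ hs.1 hαβ₁
    by_cases hαβ₂ : α ∈ S₂ ∧ β ∈ S₂
    · exact hin₂ hs.2 hαβ₂
    refine hw s hs α β (fun hβS => ?_) (not_or.2 ⟨hαβ₁, hαβ₂⟩)
    exact (hysupp _ hα).elim (fun h => hαβ₁ ⟨h.2, hβS.1⟩) fun h => hαβ₂ ⟨h.2, hβS.2⟩
  rcases hysupp _ hα with hα' | hα' <;> rcases hysupp _ hβ with hβ' | hβ'
  · exact hin₁ hα'.1 ⟨hα'.2, hβ'.2⟩
  · exact hboth ⟨hα'.1, hβ'.1⟩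
  · exact hboth ⟨hβ'.1, hα'.1⟩
  · exact hin₂ hα'.1 ⟨hα'.2, hβ'.2⟩

/-- A neighborhood of the configuration `z` inside `W` which is given by finitely many arrays and
indices, in such a way that two of these can be amalgamated by `exists_amalgam`. -/
structure BasicNeighborhood (z : Configuration Ω X) (W : Set (Configuration Ω X)) where
  indices : Finset Ω
  arrays : Finset (ClopenArray Ω X)
  assignments : Set (Node Ω X → X)
  separates : Separates (indices : Set Ω) (arrays : Set (ClopenArray Ω X))
  isOpen_assignments : IsOpen assignments
  fst_mem_assignments : z.1 ∈ assignments
  dependsOn_assignments : DependsOn (· ∈ assignments) (nodesOver (indices : Set Ω))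
  satisfies : ∀ v ∈ assignments, ∀ s ∈ arrays, Satisfies v s (indices ∩ selected z.2 s)
  mem_of_eqOn : ∀ w : Configuration Ω X, w.1 ∈ assignments →
    EqOn w.2 z.2 ((arrays : Set (ClopenArray Ω X)) ×ˢ (indices : Set Ω)) → w ∈ W

theorem nonempty_basicNeighborhood {W : Set (Configuration Ω X)} (hW : IsOpen W)
    {z : Configuration Ω X} (hzW : z ∈ W) (hz : z ∈ constraintSet Ω X) :
    Nonempty (BasicNeighborhood z W) := by
  classical
  obtain ⟨U₀, V₀, hU₀, hV₀, hzU₀, hzV₀, hUV⟩ := isOpen_prod_iff.1 hW z.1 z.2 hzW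
  obtain ⟨Q, O, hO, hzO, hQU₀⟩ := exists_isOpen_finset_pi_subset hU₀ hzU₀
  obtain ⟨P, O', -, hzO', hPV₀⟩ := exists_isOpen_finset_pi_subset hV₀ hzV₀
  let A := P.image Prod.fst
  obtain ⟨S, hS, hSA⟩ := exists_finset_separates
    (Q.image (·.1) ∪ Q.image (·.2.1) ∪ P.image Prod.snd) A
  simp only [Finset.union_subset_iff, Finset.image_subset_iff] at hS
  obtain ⟨⟨hQcol, hQrow⟩, hPS⟩ := hS
  have hdep : DependsOn (fun v => v ∈ (Q : Set (Node Ω X)).pi O ∧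
      ∀ s ∈ A, Satisfies v s (S ∩ selected z.2 s)) (nodesOver (S : Set Ω)) := by
    intro v w hvw
    have hpi : v ∈ (Q : Set (Node Ω X)).pi O ↔ w ∈ (Q : Set (Node Ω X)).pi O :=
      forall₂_congr fun q hq => by rw [hvw q ⟨hQcol q hq, hQrow q hq⟩]
    have hsat (s) : Satisfies v s (S ∩ selected z.2 s) ↔ Satisfies w s (S ∩ selected z.2 s) :=
      (dependsOn_satisfies s _ fun q hq => hvw q ⟨hq.1.1, hq.2.1⟩).to_iff
    simp only [hpi, hsat]
  exact ⟨{
    indices := S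
    arrays := A
    assignments := (Q : Set (Node Ω X)).pi O ∩ ⋂ s ∈ A, {v | Satisfies v s (S ∩ selected z.2 s)}
    separates := hSA
    isOpen_assignments := (isOpen_set_pi Q.finite_toSet fun q _ => hO q).inter <|
      isOpen_biInter_finset fun s _ =>
        (isClopen_setOf_satisfies s (S.finite_toSet.inter_of_left _)).isOpen
    fst_mem_assignments :=
      ⟨fun q _ => hzO q, mem_iInter₂.2 fun s _ => (hz s).mono inter_subset_right⟩
    dependsOn_assignments := by simpa only [mem_inter_iff, mem_iInter₂, mem_ofPred_eq] using hdep
    satisfies := fun v hv s hs => mem_iInter₂.1 hv.2 s hs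
    mem_of_eqOn := fun w hwU hwz => hUV ⟨hQU₀ hwU.1, hPV₀ fun p hp =>
      hwz ⟨Finset.mem_image_of_mem _ hp, hPS p hp⟩ ▸ hzO' p⟩ }⟩

theorem propertyK_constraintSet (hX : PropertyK X) : PropertyK (constraintSet Ω X) := by
  classical
  intro ι W hWo hWne
  choose W' hW'o hW' using fun i => isOpen_induced_iff.1 (hWo i)
  obtain rfl : (fun i => Subtype.val ⁻¹' W' i) = W := funext hW'
  choose z hz using hWne
  let N (i : ι) : BasicNeighborhood (z i).1 (W' i) :=
    (nonempty_basicNeighborhood (hW'o i) (hz i) (z i).2).some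
  refine (((PropertyK.pi fun _ => hX) ι (fun i => (N i).assignments)
    (fun i => (N i).isOpen_assignments) fun i => ⟨_, (N i).fst_mem_assignments⟩).and
    (HasUncountableCliques.forall_mem_inter (fun i => (N i).arrays ×ˢ (N i).indices)
      fun p => hasUncountableCliques_map_eq fun i => (z i).1.2 p)).mono fun i j hij => ?_
  obtain ⟨⟨v, hvi, hvj⟩, hsel⟩ := hij
  obtain ⟨w, hw, hwv, hwi, hwj⟩ := exists_amalgam (N i).separates (N j).separates
    ((N i).satisfies v hvi) ((N j).satisfies v hvj)
    fun p hp => hsel p (by simpa only [Finset.mem_inter, Finset.mem_product] using! hp)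
  refine ⟨⟨w, hw⟩, (N i).mem_of_eqOn w ?_ hwi, (N j).mem_of_eqOn w ?_ hwj⟩
  · exact ((N i).dependsOn_assignments fun q hq => hwv (.inl hq)).mpr hvi
  · exact ((N j).dependsOn_assignments fun q hq => hwv (.inr hq)).mpr hvj

/-- The configuration given by the assignment `v`, in which the array `s` selects the finite set
`F s` if this meets all constraints, and nothing otherwise. -/
noncomputable def finiteSelection (p : (Node Ω X → X) × (ClopenArray Ω X → Finset Ω)) :
    Configuration Ω X :=
  (p.1, fun (s, α) =>
    {q : (Node Ω X → X) × Finset Ω | α ∈ q.2 ∧ Satisfies q.1 s q.2}.boolIndicator (p.1, p.2 s))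

theorem mem_selected_finiteSelection {p : (Node Ω X → X) × (ClopenArray Ω X → Finset Ω)}
    {s : ClopenArray Ω X} {α : Ω} :
    α ∈ selected (finiteSelection p).2 s ↔ α ∈ p.2 s ∧ Satisfies p.1 s (p.2 s) :=
  (mem_iff_boolIndicator _ _).symm

theorem finiteSelection_mem_constraintSet
    (p : (Node Ω X → X) × (ClopenArray Ω X → Finset Ω)) :
    finiteSelection p ∈ constraintSet Ω X := by
  intro s α hα β hβ
  rw [mem_selected_finiteSelection] at hα hβ
  exact hα.2 α hα.1 β hβ.1

theorem continuous_finiteSelection [TopologicalSpace (Finset Ω)] [DiscreteTopology (Finset Ω)] :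
    Continuous (finiteSelection (Ω := Ω) (X := X)) := by
  refine continuous_fst.prodMk (continuous_pi fun (s, α) => ?_)
  have hcont : Continuous
      {q : (Node Ω X → X) × Finset Ω | α ∈ q.2 ∧ Satisfies q.1 s q.2}.boolIndicator := by
    refine continuous_prod_of_discrete_right.2 fun F =>
      (continuous_boolIndicator_iff_isClopen {v | α ∈ F ∧ Satisfies v s F}).2 ?_
    by_cases hα : α ∈ F
    · simpa only [hα, true_and] using isClopen_setOf_satisfies s F.finite_toSet
    · simp only [hα, false_and, ofPred_false, isClopen_empty]
  exact hcont.comp (continuous_fst.prodMk ((continuous_apply s).comp continuous_snd))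

theorem denseRange_finiteSelection :
    DenseRange fun p : (Node Ω X → X) × (ClopenArray Ω X → Finset Ω) =>
      (⟨finiteSelection p, finiteSelection_mem_constraintSet p⟩ : constraintSet Ω X) := by
  classical
  refine dense_iff_inter_open.2 fun W hW ⟨z, hzW⟩ => ?_
  obtain ⟨W', hW', rfl⟩ := isOpen_induced_iff.1 hW
  obtain ⟨N⟩ := nonempty_basicNeighborhood hW' hzW z.2
  let F (s : ClopenArray Ω X) : Finset Ω := {α ∈ N.indices | α ∈ selected z.1.2 s}
  refine ⟨_, ?_, mem_range_self (z.1.1, F)⟩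
  refine N.mem_of_eqOn _ N.fst_mem_assignments fun (s, α) hsα => ?_
  have hF : Satisfies z.1.1 s (F s) := (z.2 s).mono fun α hα => (Finset.mem_filter.1 hα).2
  have hα : α ∈ N.indices := hsα.2
  have hiff : α ∈ selected (finiteSelection (z.1.1, F)).2 s ↔ α ∈ selected z.1.2 s := by
    rw [mem_selected_finiteSelection, and_iff_left hF, Finset.mem_filter, and_iff_right hα]
  exact Bool.eq_iff_iff.2 hiff

theorem mk_node_le (h : density X ≤ #Ω) [Infinite Ω] : #(Node Ω X) ≤ 2 ^ #Ω := by
  have hΩ := aleph0_le_mk Ω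
  have hprefix (β : Ω) : #(Iio β → Ω → NonemptyClopens X) ≤ 2 ^ #Ω :=
    mk_fun_le_two_power hΩ (mk_set_le _)
      (mk_fun_le_two_power hΩ le_rfl (mk_nonemptyClopens_le_two_power h))
  calc #(Node Ω X) = #Ω * sum fun β : Ω => #(Iio β → Ω → NonemptyClopens X) := by
        rw [mk_prod, mk_sigma, lift_id, lift_id]
    _ ≤ #Ω * sum fun _ : Ω => 2 ^ #Ω := by gcongr; exact hprefix _
    _ ≤ 2 ^ #Ω := by
        rw [sum_const', ← mul_assoc, mul_eq_self hΩ]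
        exact mul_le_of_le (hΩ.trans (cantor _).le) (cantor _).le le_rfl

theorem density_constraintSet_le (h : density X ≤ #Ω) [Infinite Ω] :
    density (constraintSet Ω X) ≤ #Ω := by
  let _ : TopologicalSpace (Finset Ω) := ⊥
  have : DiscreteTopology (Finset Ω) := ⟨rfl⟩
  have hnodes : density (Node Ω X → X) ≤ #Ω :=
    density_pi_le (aleph0_le_mk Ω) (mk_node_le h) fun _ => h
  have hselections : density (ClopenArray Ω X → Finset Ω) ≤ #Ω :=
    density_pi_le (aleph0_le_mk Ω) (mk_clopenArray_le h) fun _ =>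
      (density_of_discreteTopology.trans (mk_finset_of_infinite Ω)).le
  calc density (constraintSet Ω X)
      ≤ density ((Node Ω X → X) × (ClopenArray Ω X → Finset Ω)) :=
        density_le_density_of_denseRange denseRange_finiteSelection
          (continuous_finiteSelection.subtype_mk _)
    _ ≤ density (Node Ω X → X) * density (ClopenArray Ω X → Finset Ω) := density_prod_le
    _ ≤ #Ω * #Ω := mul_le_mul' hnodes hselections
    _ = #Ω := mul_eq_self (aleph0_le_mk Ω)

theorem exists_mem_constraintSet_mem_selected [Nonempty X] (s : ClopenArray Ω X) (α : Ω) :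
    ∃ z ∈ constraintSet Ω X, α ∈ selected z.2 s := by
  classical
  let v : Node Ω X → X := fun _ => Classical.arbitrary X
  refine ⟨finiteSelection (v, fun _ => {α}), finiteSelection_mem_constraintSet _, ?_⟩
  rw [mem_selected_finiteSelection]
  refine ⟨Finset.mem_singleton_self α, fun γ hγ δ hδ hγδ => absurd hγδ ?_⟩
  simp only [Finset.coe_singleton, mem_singleton_iff] at hγ hδ
  simp [hγ, hδ]

theorem lt_density_constraintSet [WellFoundedLT Ω] [CompactSpace X] [T2Space X]
    [TotallyDisconnectedSpace X] {K : Type u} [LinearOrder K] [Infinite K]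
    (hK : ∀ k : K, #(Iic k) < #K) (hKΩ : #K < #Ω) (hΩ : ∀ β : Ω, #(Iic β) ≤ #K)
    (hX : #K ≤ density X) : #K < density (constraintSet Ω X) := by
  by_contra! hdensity
  obtain ⟨D, hD, hDcard⟩ := exists_dense_mk_eq_density (constraintSet Ω X)
  obtain ⟨rank⟩ : Nonempty (D ↪ K) := by rwa [← hDcard] at hdensity
  choose e he using fun β => exists_injOn_of_mk_le (hΩ β)
  have havoid (q : Node Ω X) :
      ∃ a : NonemptyClopens X, ∀ x : D, rank x ≤ e q.2.1 q.1 → x.1.1.1 q ∉ a.1 := by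
    have hsmall : #((fun x : D => x.1.1.1 q) '' {x | rank x ≤ e q.2.1 q.1}) < density X :=
      calc #((fun x : D => x.1.1.1 q) '' {x | rank x ≤ e q.2.1 q.1})
          ≤ #(rank ⁻¹' Iic (e q.2.1 q.1)) := mk_image_le
        _ ≤ #(Iic (e q.2.1 q.1)) := mk_preimage_of_injective _ _ rank.injective
        _ < #K := hK _
        _ ≤ density X := hX
    obtain ⟨a, ha, hdisj⟩ := exists_clopens_disjoint_of_mk_lt_density hsmall
    exact ⟨⟨a, ha⟩, fun x hx hxa => disjoint_left.1 hdisj hxa (mem_image_of_mem _ hx)⟩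
  obtain ⟨s, hs⟩ := exists_forall_node havoid
  have : Nonempty X := nonempty_of_density_ne_zero
    ((aleph0_pos.trans_le ((aleph0_le_mk K).trans hX)).ne')
  have hselect (α : Ω) : ∃ x : D, α ∈ selected x.1.1.2 s := by
    obtain ⟨z, hz, hzα⟩ := exists_mem_constraintSet_mem_selected s α
    obtain ⟨x, hxD, hx⟩ := hD.exists_mem_open
      ((isOpen_setOf_mem_selected s α).preimage continuous_subtype_val) ⟨⟨z, hz⟩, hzα⟩
    exact ⟨⟨x, hxD⟩, hx⟩
  choose x hx using hselect
  obtain ⟨α, β, hαβ, hxαβ, hlt⟩ := exists_lt_map_eq_lt hK hKΩ hΩ he (rank ∘ x)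
  have hxα : α ∈ selected (x β).1.1.2 s := rank.injective hxαβ ▸ hx α
  exact hs α β (x β) hlt.le ((x β).1.2 s α hxα β (hx β) hαβ)

end ClopenArray

section Induction

theorem exists_profinite_propertyK_density_of_lt_aleph0 {κ : Cardinal.{u}} (hκ : κ < ℵ₀) :
    ∃ X : Profinite.{u}, PropertyK X ∧ density X = κ := by
  have : Finite κ.out := lt_aleph0_iff_finite.1 (by rwa [mk_out])
  let _ : TopologicalSpace κ.out := ⊥
  have : DiscreteTopology κ.out := ⟨rfl⟩
  exact ⟨.of κ.out, propertyK_of_separableSpace κ.out,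
    density_of_discreteTopology.trans (mk_out κ)⟩

theorem exists_linearOrder_mk_Iic_lt {κ : Cardinal.{u}} (hκ : ℵ₀ ≤ κ) :
    ∃ (Ω : Type u) (_ : LinearOrder Ω), WellFoundedLT Ω ∧ #Ω = κ ∧ ∀ β : Ω, #(Iic β) < κ :=
  ⟨κ.ord.ToType, inferInstance, inferInstance, mk_ord_toType κ, fun β => by
    simpa only [mk_ord_toType] using mk_Iic_lt β (by simp) (by simpa using hκ)⟩

theorem exists_profinite_propertyK_density_succ {κ : Cardinal.{u}} (hκ : ℵ₀ ≤ κ)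
    {X : Profinite.{u}} (hX : PropertyK X) (hXκ : density X = κ) :
    ∃ Y : Profinite.{u}, PropertyK Y ∧ density Y = Order.succ κ := by
  obtain ⟨K, _, -, rfl, hK⟩ := exists_linearOrder_mk_Iic_lt hκ
  have hlt : #K < Order.succ #K := Order.lt_succ _
  obtain ⟨Ω, _, _, hΩκ, hΩ⟩ := exists_linearOrder_mk_Iic_lt (hκ.trans hlt.le)
  have : Infinite K := infinite_iff.2 hκ
  have : Infinite Ω := infinite_iff.2 (hΩκ ▸ hκ.trans hlt.le)
  have : CompactSpace (ClopenArray.constraintSet Ω X) :=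
    isCompact_iff_compactSpace.1 ClopenArray.isClosed_constraintSet.isCompact
  refine ⟨.of (ClopenArray.constraintSet Ω X), ClopenArray.propertyK_constraintSet hX,
    le_antisymm ?_ (Order.succ_le_of_lt ?_)⟩
  · exact hΩκ ▸ ClopenArray.density_constraintSet_le (by rw [hXκ, hΩκ]; exact hlt.le)
  · exact ClopenArray.lt_density_constraintSet hK (hΩκ ▸ hlt)
      (fun β => Order.lt_succ_iff.1 (hΩ β)) hXκ.ge

theorem exists_profinite_propertyK_density_of_isSuccLimit {κ : Cardinal.{u}}
    (hlim : Order.IsSuccLimit κ)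
    (ih : ∀ c < κ, ∃ X : Profinite.{u}, PropertyK X ∧ density X = c) :
    ∃ X : Profinite.{u}, PropertyK X ∧ density X = κ := by
  let T := {S : Set κ.out // #S < κ}
  choose X hX hXS using fun S : T => ih (Order.succ #S.1) (hlim.succ_lt S.2)
  have hne (S : T) : Nonempty (X S) :=
    nonempty_of_density_ne_zero (hXS S ▸ Order.succ_ne_bot _)
  have hT : #T ≤ 2 ^ κ := (mk_subtype_le _).trans_eq (by rw [mk_set, mk_out])
  refine ⟨.of (∀ S, X S), PropertyK.pi hX, le_antisymm ?_ (le_of_forall_lt fun c hc => ?_)⟩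
  · exact density_pi_le (aleph0_le_of_isSuccLimit hlim) hT fun S =>
      (hXS S).trans_le (hlim.succ_lt S.2).le
  · obtain ⟨S, rfl⟩ := le_mk_iff_exists_set.1 (hc.le.trans_eq (mk_out κ).symm)
    calc #S < Order.succ #S := Order.lt_succ _
      _ = density (X ⟨S, hc⟩) := (hXS ⟨S, hc⟩).symm
      _ ≤ density (∀ S, X S) := density_le_density_of_denseRange
        (Function.surjective_eval (β := fun S : T => X S) ⟨S, hc⟩).denseRange
        (continuous_apply _)

theorem exists_profinite_propertyK_density (κ : Cardinal.{u}) :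
    ∃ X : Profinite.{u}, PropertyK X ∧ density X = κ := by
  induction κ using SuccOrder.limitRecOn with
  | isMin κ hκ =>
    exact exists_profinite_propertyK_density_of_lt_aleph0 (hκ.eq_bot ▸ aleph0_pos)
  | succ κ _ ih =>
    rcases lt_or_ge κ ℵ₀ with hκ | hκ
    · exact exists_profinite_propertyK_density_of_lt_aleph0 (isSuccLimit_aleph0.succ_lt hκ)
    · obtain ⟨X, hX, hXκ⟩ := ih
      exact exists_profinite_propertyK_density_succ hκ hX hXκ
  | isSuccLimit κ hκ ih => exact exists_profinite_propertyK_density_of_isSuccLimit hκ ih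

end Induction

section StoneDuality

variable {X : Type u} [TopologicalSpace X]

theorem clopens_coe_nonempty {a : Clopens X} : (a : Set X).Nonempty ↔ a ≠ ⊥ :=
  nonempty_iff_ne_empty.trans (SetLike.coe_injective.ne_iff' Clopens.coe_bot)

theorem PropertyK.baCountableChainCondition (hX : PropertyK X) :
    BACountableChainCondition (Clopens X) := by
  intro A hA hdisj
  by_contra hAc
  obtain ⟨J, -, hJc, hJ⟩ := hX A (fun a => a.1) (fun a => a.1.isClopen.isOpen)
    (fun a => clopens_coe_nonempty.2 (hA a a.2)) univ
    (by rwa [countable_univ_iff, countable_coe_iff])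
  obtain ⟨a, ha, b, hb, hab⟩ := not_subsingleton_iff.1 fun h : J.Subsingleton => hJc h.countable
  obtain ⟨x, hxa, hxb⟩ := hJ ha hb hab
  exact (hdisj a.2 b.2 (Subtype.coe_ne_coe.2 hab)).le_bot ⟨hxa, hxb⟩

/-- The filter of clopen sets containing the point `x`. In a Stone space these are all the
ultrafilters of the algebra of clopen sets. -/
def pointFilter (x : X) : Order.PFilter (Clopens X) :=
  (Order.IsPFilter.of_def (F := {a : Clopens X | x ∈ a}) ⟨⊤, mem_univ x⟩
    (fun a ha b hb => ⟨a ⊓ b, ⟨ha, hb⟩, inf_le_left, inf_le_right⟩)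
    fun hab ha => hab ha).toPFilter

theorem mem_pointFilter {x : X} {a : Clopens X} : a ∈ pointFilter x ↔ x ∈ a := Iff.rfl

theorem isBAUltrafilter_pointFilter (x : X) : IsBAUltrafilter (pointFilter x) := by
  refine ⟨fun h : x ∈ (⊥ : Clopens X) => h, fun G hG hle a ha => ?_⟩
  by_contra hxa
  have hac : aᶜ ∈ G := hle (show x ∈ aᶜ from hxa)
  exact hG (inf_compl_self a ▸ Order.PFilter.inf_mem ha hac)

theorem exists_forall_mem_of_bot_notMem [CompactSpace X] {D : Order.PFilter (Clopens X)}
    (hD : ⊥ ∉ D) : ∃ x, ∀ a ∈ D, x ∈ a := by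
  have : Nonempty {a // a ∈ D} := D.nonempty.to_subtype
  obtain ⟨x, hx⟩ := IsCompact.nonempty_iInter_of_directed_nonempty_isCompact_isClosed
    (fun a : {a // a ∈ D} => (a.1 : Set X))
    (fun a b => ⟨⟨a.1 ⊓ b.1, Order.PFilter.inf_mem a.2 b.2⟩, inter_subset_left,
      inter_subset_right⟩)
    (fun a => clopens_coe_nonempty.2 fun h => hD (h ▸ a.2))
    (fun a => a.1.isClopen.isClosed.isCompact) fun a => a.1.isClopen.isClosed
  exact ⟨x, fun a ha => mem_iInter.1 hx ⟨a, ha⟩⟩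

theorem coveredByUltrafilters_density : CoveredByUltrafilters (Clopens X) (density X) := by
  obtain ⟨D, hD, hDX⟩ := exists_dense_mk_eq_density X
  refine ⟨D, fun x => pointFilter x.1, hDX, fun x => isBAUltrafilter_pointFilter x.1, ?_⟩
  ext a
  simp only [mem_iUnion, SetLike.mem_coe, mem_pointFilter, mem_ofPred_eq, ← clopens_coe_nonempty]
  refine ⟨fun ⟨x, hx⟩ => ⟨x, hx⟩, fun ha => ?_⟩
  obtain ⟨x, hxD, hxa⟩ := hD.exists_mem_open a.isClopen.isOpen ha
  exact ⟨⟨x, hxD⟩, hxa⟩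

theorem CoveredByUltrafilters.density_le [CompactSpace X] [T2Space X]
    [TotallyDisconnectedSpace X] {κ : Cardinal.{u}} (h : CoveredByUltrafilters (Clopens X) κ) :
    density X ≤ κ := by
  obtain ⟨ι, U, rfl, hU, hcov⟩ := h
  choose x hx using fun i => exists_forall_mem_of_bot_notMem (hU i).prop
  by_contra! hlt
  obtain ⟨a, ha, hdisj⟩ := exists_clopens_disjoint_of_mk_lt_density (mk_range_le.trans_lt hlt)
  obtain ⟨i, hi⟩ := mem_iUnion.1 (hcov.ge (clopens_coe_nonempty.1 ha))
  exact disjoint_left.1 hdisj (hx i a hi) (mem_range_self i)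

theorem topologicalDensity_clopens [CompactSpace X] [T2Space X] [TotallyDisconnectedSpace X] :
    topologicalDensity (Clopens X) = density X :=
  IsLeast.csInf_eq ⟨coveredByUltrafilters_density, fun _ => CoveredByUltrafilters.density_le⟩

end StoneDuality

theorem theorem1p1_general (μ : Cardinal.{u}) : ∃ (B : Type u) (_ : BooleanAlgebra B),
    BACountableChainCondition B ∧ topologicalDensity B = μ := by
  obtain ⟨X, hX, hXμ⟩ := exists_profinite_propertyK_density μ
  exact ⟨Clopens X, inferInstance, hX.baCountableChainCondition,
    topologicalDensity_clopens.trans hXμ⟩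

theorem theorem1p1 (μ : Cardinal.{u}) (hμ : Cardinal.aleph0 < μ) :
    ∃ (B : Type u) (_ : BooleanAlgebra B),
      BACountableChainCondition B ∧ topologicalDensity B = μ :=
  theorem1p1_general μ
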